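/- An oriented matroid $\vec M=(E,\mathcal C)$ consists of a finite ground set $E$ and a collection $\mathcal C$ of signed circuits, i.e. pairs $(C^+,C^-)$ of disjoint subsets of $E$ satisfying the usual signed circuit axioms; the supports $C^+\cup C^-$ are the circuits of the underlying matroid $M$. Suppose that $M$ is regular, i.e. representable over every field. A circuit $C$ of $M$ is called directed if $(C,\emptyset)\in\mathcal C$ (equivalently $(\emptyset,C)\in\mathcal C$), and an oriented matroid is called totally cyclic if every element of its ground set lies in a directed circuit. The circuit space of $M$ is the subspace of $\mathbb F_2^{E}$ spanned by the incidence vectors of the circuits of $M$; a directed circuit basis of $M$ is a set of directed circuits of $\vec M$ whose incidence vectors form a basis of the circuit space. For $A\subseteq E$, let $\vec M-A$ be the deletion of $A$, i.e. the oriented matroid on $E\setminus A$ whose signed circuits are those $(C^+,C^-)\in\mathcal C$ with $(C^+\cup C^-)\cap A=\emptyset$. (1) If $\vec M$ is totally cyclic, then $M$ admits a directed circuit basis. (2) For every coindependent set $A$ of $M$ (i.e. $A$ is independent in the dual matroid $M^*$) such that $\vec M-A$ is totally cyclic, there exists a directed circuit basis of $M$ such that every $a\in A$ is contained in exactly one circuit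 of the basis. -/

import Mathlib

universe u v

/-- An oriented matroid on a finite ground set `E`, given by its signed circuits: pairs
`(C⁺, C⁻)` of disjoint subsets of `E` satisfying the signed circuit axioms. -/
structure OrientedMatroid (α : Type u) where
  /-- The ground set. -/
  E : Set α
  ground_finite : E.Finite
  /-- The collection of signed circuits. -/
  circuits : Set (Set α × Set α)
  subset_ground : ∀ X ∈ circuits, X.1 ∪ X.2 ⊆ E
  disjoint : ∀ X ∈ circuits, Disjoint X.1 X.2
  empty_notMem : ((∅, ∅) : Set α × Set α) ∉ circuits
  swap_mem : ∀ X ∈ circuits, X.swap ∈ circuits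
  incomparable : ∀ X ∈ circuits, ∀ Y ∈ circuits, X.1 ∪ X.2 ⊆ Y.1 ∪ Y.2 → X = Y ∨ X = Y.swap
  elimination : ∀ X ∈ circuits, ∀ Y ∈ circuits, X ≠ Y.swap → ∀ e ∈ X.1 ∩ Y.2,
    ∃ Z ∈ circuits, Z.1 ⊆ (X.1 ∪ Y.1) \ {e} ∧ Z.2 ⊆ (X.2 ∪ Y.2) \ {e}

namespace OrientedMatroid

/-- `C` is the support of some signed circuit. -/
def IsSupport {α : Type u} (O : OrientedMatroid α) (C : Set α) : Prop :=
  ∃ X ∈ O.circuits, X.1 ∪ X.2 = C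

/-- A subset of the ground set is independent if it contains no support of a signed circuit. -/
def IsIndep {α : Type u} (O : OrientedMatroid α) (I : Set α) : Prop :=
  I ⊆ O.E ∧ ∀ C, O.IsSupport C → ¬ C ⊆ I

theorem IsSupport.subset_ground {α : Type u} {O : OrientedMatroid α} {C : Set α}
    (h : O.IsSupport C) : C ⊆ O.E := by
  obtain ⟨X, hX, rfl⟩ := h
  exact O.subset_ground X hX

theorem IsSupport.nonempty {α : Type u} {O : OrientedMatroid α} {C : Set α}
    (h : O.IsSupport C) : C.Nonempty := by
  obtain ⟨X, hX, rfl⟩ := h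
  by_contra hne
  rw [Set.not_nonempty_iff_eq_empty, Set.union_empty_iff] at hne
  apply O.empty_notMem
  rw [← hne.1]
  nth_rewrite 2 [hne.1]
  rw [← hne.2]
  exact hX

theorem IsSupport.eq_of_subset {α : Type u} {O : OrientedMatroid α} {C D : Set α}
    (hC : O.IsSupport C) (hD : O.IsSupport D) (h : C ⊆ D) : C = D := by
  obtain ⟨X, hX, rfl⟩ := hC
  obtain ⟨Y, hY, rfl⟩ := hD
  rcases O.incomparable X hX Y hY h with rfl | rfl
  · rfl
  · simp [Set.union_comm]

/-- Weak circuit elimination for the supports. -/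
theorem IsSupport.elimination {α : Type u} {O : OrientedMatroid α} {C D : Set α}
    (hC : O.IsSupport C) (hD : O.IsSupport D) (hne : C ≠ D) {e : α} (heC : e ∈ C) (heD : e ∈ D) :
    ∃ K, O.IsSupport K ∧ K ⊆ (C ∪ D) \ {e} := by
  obtain ⟨X, hX, heX, rfl⟩ : ∃ X ∈ O.circuits, e ∈ X.1 ∧ X.1 ∪ X.2 = C := by
    obtain ⟨X, hX, rfl⟩ := hC
    rcases heC with h | h
    · exact ⟨X, hX, h, rfl⟩
    · exact ⟨X.swap, O.swap_mem X hX, h, by simp [Set.union_comm]⟩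
  obtain ⟨Y, hY, heY, rfl⟩ : ∃ Y ∈ O.circuits, e ∈ Y.2 ∧ Y.1 ∪ Y.2 = D := by
    obtain ⟨Y, hY, rfl⟩ := hD
    rcases heD with h | h
    · exact ⟨Y.swap, O.swap_mem Y hY, h, by simp [Set.union_comm]⟩
    · exact ⟨Y, hY, h, rfl⟩
  have hXY : X ≠ Y.swap := by
    rintro rfl
    exact hne (by simp [Set.union_comm])
  obtain ⟨Z, hZ, h1, h2⟩ := O.elimination X hX Y hY hXY e ⟨heX, heY⟩
  refine ⟨_, ⟨Z, hZ, rfl⟩, ?_⟩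
  rintro x (hx | hx)
  · have := h1 hx
    simp only [Set.mem_sdiff, Set.mem_union, Set.mem_singleton_iff] at this ⊢
    tauto
  · have := h2 hx
    simp only [Set.mem_sdiff, Set.mem_union, Set.mem_singleton_iff] at this ⊢
    tauto

theorem IsIndep.subset {α : Type u} {O : OrientedMatroid α} {I J : Set α}
    (hJ : O.IsIndep J) (h : I ⊆ J) : O.IsIndep I :=
  ⟨h.trans hJ.1, fun C hC hCI => hJ.2 C hC (hCI.trans h)⟩

theorem IsIndep.augment {α : Type u} {O : OrientedMatroid α} {I J : Set α}
    (hI : O.IsIndep I) (hJ : O.IsIndep J) (hlt : I.ncard < J.ncard) :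
    ∃ e ∈ J, e ∉ I ∧ O.IsIndep (insert e I) := by
  by_contra! hcon
  have fin : ∀ {K : Set α}, O.IsIndep K → K.Finite := fun h => O.ground_finite.subset h.1
  have hex : ∃ n, ∃ K, O.IsIndep K ∧ K ⊆ I ∪ J ∧ I.ncard < K.ncard ∧ (I \ K).ncard = n :=
    ⟨_, J, hJ, Set.subset_union_right, hlt, rfl⟩
  classical
  obtain ⟨K, hK, hKIJ, hIK, hKn⟩ := Nat.find_spec hex
  have hmin : ∀ L, O.IsIndep L → L ⊆ I ∪ J → I.ncard < L.ncard →
      (I \ K).ncard ≤ (I \ L).ncard := by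
    intro L h1 h2 h3
    rw [hKn]
    exact Nat.find_min' hex ⟨L, h1, h2, h3, rfl⟩
  obtain ⟨g, hgK, hgI⟩ : ∃ g ∈ K, g ∉ I := by
    by_contra! h
    exact absurd (Set.ncard_le_ncard h (fin hI)) (by omega)
  obtain ⟨e, heI, heK⟩ : ∃ e ∈ I, e ∉ K := by
    by_contra! h
    have hgJ : g ∈ J := (hKIJ hgK).resolve_left hgI
    exact hcon g hgJ hgI (hK.subset (Set.insert_subset hgK h))
  have key : ∀ f ∈ K, f ∉ I → ∃ C, O.IsSupport C ∧ C ⊆ insert e K ∧ f ∉ C ∧ e ∈ C := by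
    intro f hfK hfI
    have hcard : (insert e (K \ {f})).ncard = K.ncard := by
      rw [Set.ncard_insert_of_notMem (fun h => heK h.1) ((fin hK).subset Set.sdiff_subset)]
      exact Set.ncard_sdiff_singleton_add_one hfK (fin hK)
    have hsub : insert e (K \ {f}) ⊆ I ∪ J :=
      Set.insert_subset (Or.inl heI) (Set.sdiff_subset.trans hKIJ)
    have hdep : ¬ O.IsIndep (insert e (K \ {f})) := by
      intro hind
      have hle := hmin _ hind hsub (by omega)
      have hss : I \ insert e (K \ {f}) ⊂ I \ K := by
        refine ⟨fun x hx => ⟨hx.1, fun hxK => hx.2 (Or.inr ⟨hxK, ?_⟩)⟩, fun h => ?_⟩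
        · rintro rfl
          exact hfI hx.1
        · exact (h ⟨heI, heK⟩).2 (Or.inl rfl)
      exact absurd (Set.ncard_lt_ncard hss ((fin hI).subset Set.sdiff_subset)) (by omega)
    have : ∃ C, O.IsSupport C ∧ C ⊆ insert e (K \ {f}) := by
      by_contra! h
      exact hdep ⟨Set.insert_subset (hI.1 heI) (Set.sdiff_subset.trans hK.1), h⟩
    obtain ⟨C, hC, hCs⟩ := this
    refine ⟨C, hC, hCs.trans (Set.insert_subset_insert Set.sdiff_subset), fun hfC => ?_, ?_⟩
    · rcases hCs hfC with rfl | h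
      · exact heK hfK
      · exact h.2 rfl
    · by_contra heC
      refine hK.2 C hC fun x hx => ?_
      rcases hCs hx with rfl | h
      · exact absurd hx heC
      · exact h.1
  obtain ⟨C, hC, hCK, hgC, heC⟩ := key g hgK hgI
  obtain ⟨h, hhC, hhI⟩ : ∃ h ∈ C, h ∉ I := by
    by_contra! hh
    exact hI.2 C hC hh
  have hhK : h ∈ K := by
    rcases hCK hhC with rfl | h'
    · exact absurd heI hhI
    · exact h'
  obtain ⟨D, hD, hDK, hhD, heD⟩ := key h hhK hhI
  obtain ⟨Z, hZ, hZs⟩ := hC.elimination hD (fun hCD => hhD (hCD ▸ hhC)) heC heD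
  refine hK.2 Z hZ fun x hx => ?_
  obtain ⟨hx1 | hx1, hx2⟩ := hZs hx
  · exact (hCK hx1).resolve_left hx2
  · exact (hDK hx1).resolve_left hx2

/-- The underlying matroid: its circuits are the supports of the signed circuits
(see `underlying_isCircuit_iff`). -/
def underlying {α : Type u} (O : OrientedMatroid α) : Matroid α :=
  (IndepMatroid.ofFinite O.ground_finite O.IsIndep
    ⟨Set.empty_subset _, fun _ hC h => hC.nonempty.ne_empty (Set.subset_empty_iff.1 h)⟩
    (fun _ _ hJ h => hJ.subset h)
    (fun _ _ hI hJ hlt => hI.augment hJ hlt)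
    (fun _ hI => hI.1)).matroid

theorem underlying_ground {α : Type u} (O : OrientedMatroid α) : O.underlying.E = O.E := rfl

theorem underlying_indep_iff {α : Type u} (O : OrientedMatroid α) (I : Set α) :
    O.underlying.Indep I ↔ O.IsIndep I :=
  Iff.rfl

theorem underlying_isCircuit_iff {α : Type u} (O : OrientedMatroid α) (C : Set α) :
    O.underlying.IsCircuit C ↔ O.IsSupport C := by
  have hdep : ∀ D, O.underlying.Dep D ↔ D ⊆ O.E ∧ ∃ K, O.IsSupport K ∧ K ⊆ D := by
    intro D
    rw [Matroid.Dep, underlying_indep_iff, IsIndep, underlying_ground]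
    push Not
    exact ⟨fun h => ⟨h.2, h.1 h.2⟩, fun h => ⟨fun _ => h.2, h.1⟩⟩
  rw [Matroid.isCircuit_iff]
  constructor
  · rintro ⟨hC, hmin⟩
    obtain ⟨hCE, K, hK, hKC⟩ := (hdep C).1 hC
    rwa [← hmin ((hdep K).2 ⟨hKC.trans hCE, K, hK, subset_rfl⟩) hKC]
  · intro hC
    refine ⟨(hdep C).2 ⟨hC.subset_ground, C, hC, subset_rfl⟩, fun D hD hDC => ?_⟩
    obtain ⟨_, K, hK, hKD⟩ := (hdep D).1 hD
    exact hDC.antisymm ((hK.eq_of_subset hC (hKD.trans hDC)) ▸ hKD)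

/-- A set `C` is a directed circuit if `(C, ∅)` (equivalently `(∅, C)`) is a signed circuit. -/
def IsDirectedCircuit {α : Type u} (O : OrientedMatroid α) (C : Set α) : Prop :=
  ((C, ∅) : Set α × Set α) ∈ O.circuits

/-- Every element lies in a directed circuit. -/
def IsTotallyCyclic {α : Type u} (O : OrientedMatroid α) : Prop :=
  ∀ e ∈ O.E, ∃ C, O.IsDirectedCircuit C ∧ e ∈ C

/-- The deletion of a set `A` of elements: the signed circuits are those whose support
avoids `A`. -/
def delete {α : Type u} (O : OrientedMatroid α) (A : Set α) : OrientedMatroid α where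
  E := O.E \ A
  ground_finite := O.ground_finite.subset Set.sdiff_subset
  circuits := {X | X ∈ O.circuits ∧ Disjoint (X.1 ∪ X.2) A}
  subset_ground X hX := Set.subset_sdiff.2 ⟨O.subset_ground X hX.1, hX.2⟩
  disjoint X hX := O.disjoint X hX.1
  empty_notMem h := O.empty_notMem h.1
  swap_mem X hX := ⟨O.swap_mem X hX.1, by simpa [Set.union_comm] using hX.2⟩
  incomparable X hX Y hY h := O.incomparable X hX.1 Y hY.1 h
  elimination X hX Y hY hne e he := by
    obtain ⟨Z, hZ, h1, h2⟩ := O.elimination X hX.1 Y hY.1 hne e he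
    refine ⟨Z, ⟨hZ, ?_⟩, h1, h2⟩
    refine Disjoint.mono_left ?_ (hX.2.union_left hY.2)
    rintro x (hx | hx)
    · exact (h1 hx).1.imp Or.inl Or.inl
    · exact (h2 hx).1.imp Or.inr Or.inr

end OrientedMatroid

namespace Matroid

/-- `M` is representable over `F`: it is the column matroid of a matrix over `F` whose columns
are indexed by the elements of `M` (columns indexed outside the ground set play no role). -/
def IsRepresentableOver {α : Type u} (M : Matroid α) (F : Type v) [Field F] : Prop :=
  ∃ (n : ℕ) (A : Matrix (Fin n) α F), ∀ I ⊆ M.E, M.Indep I ↔ LinearIndepOn F A.col I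

/-- A regular matroid is representable over every field. -/
def IsRegular {α : Type u} (M : Matroid α) : Prop :=
  ∀ (F : Type v) [Field F], M.IsRepresentableOver F

/-- The incidence vector over `𝔽₂` of a set. A vector of `𝔽₂^E` is regarded as a vector indexed
by the ambient type that vanishes outside `E`. -/
noncomputable def incidenceVector {α : Type u} (C : Set α) : α → ZMod 2 :=
  C.indicator 1

/-- The circuit space: the `𝔽₂`-span of the incidence vectors of the circuits. -/
noncomputable def circuitSpace {α : Type u} (M : Matroid α) : Submodule (ZMod 2) (α → ZMod 2) :=
  Submodule.span (ZMod 2) (incidenceVector '' {C | M.IsCircuit C})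

/-- A circuit basis: a set of circuits whose incidence vectors form a basis of the
circuit space. -/
def IsCircuitBasis {α : Type u} (M : Matroid α) (B : Set (Set α)) : Prop :=
  (∀ C ∈ B, M.IsCircuit C) ∧
  LinearIndepOn (ZMod 2) incidenceVector B ∧
  Submodule.span (ZMod 2) (incidenceVector '' B) = M.circuitSpace

end Matroid

/-- A circuit basis of the underlying matroid is directed if all its members are directed
circuits. -/
def OrientedMatroid.IsDirectedCircuitBasis {α : Type u} (O : OrientedMatroid α)
    (B : Set (Set α)) : Prop :=
  O.underlying.IsCircuitBasis B ∧ ∀ C ∈ B, O.IsDirectedCircuit C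

/-! Signed circuits are treated as integer vectors, and directed circuits are found by decomposing
nonnegative flows. Regularity enters through a representation over `𝔽₂`: together with signed
elimination, it makes the signed circuits that are fundamental for a base span all signed circuits
over `ℤ` (`signVector_mem_span_fundamental`). Hence a flow supported on a base is zero, so the
support of a nonzero flow contains a circuit. Subtracting circuits from a nonnegative flow then
splits it into directed circuits (`mem_closure_directed_of_nonneg`).

If the deletion of `A` is totally cyclic, the sum of directed circuits covering its ground set is a
flow `p` that vanishes on `A` and is positive elsewhere. As `A` is coindependent, some base avoids
`A`. Adding `p` to the fundamental circuit of `a ∈ A` and decomposing the sum gives a directed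
circuit `D a` that meets `A` only in `a`. Any signed circuit minus a suitable combination of the `D
a` vanishes on `A`, and adding a multiple of `p` makes it nonnegative. So the `D a` and the directed
circuits avoiding `A` span everything over `ℤ`, and hence modulo 2. The `D a` are independent;
extending them by circuits avoiding `A` gives the basis. Part (1) is the case `A = ∅`. -/

namespace Matroid

/-! ### Circuits as linear relations over `𝔽₂` -/

theorem IsCircuit.exists_linearRelation {α : Type u} {M : Matroid α} {F W : Type*} [Field F]
    [AddCommGroup W] [Module F W] {w : α → W}
    (hw : ∀ I ⊆ M.E, M.Indep I ↔ LinearIndepOn F w I) {C : Set α} (hC : M.IsCircuit C) :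
    ∃ l : α →₀ F, Finsupp.linearCombination F w l = 0 ∧ (l.support : Set α) = C := by
  have hdep : ¬ LinearIndepOn F w C := fun h => hC.not_indep ((hw C hC.subset_ground).2 h)
  rw [linearIndepOn_iff] at hdep
  push Not at hdep
  obtain ⟨l, hlC, hl, hl0⟩ := hdep
  rw [Finsupp.mem_supported] at hlC
  refine ⟨l, hl, hlC.antisymm fun x hx => ?_⟩
  by_contra hxl
  have hind := (hw _ (Set.sdiff_subset.trans hC.subset_ground)).1 (hC.sdiff_singleton_indep hx)
  refine hl0 (linearIndepOn_iff.1 hind l ?_ hl)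
  rw [Finsupp.mem_supported]
  exact fun y hy => ⟨hlC hy, fun h => hxl (h ▸ hy)⟩

/-- In a regular (indeed, binary) matroid, the circuits that become independent after the removal
of `e` and `f` are determined by `e` and `f`. -/
theorem IsRegular.mem_circuit_iff {α : Type u} {M : Matroid α} (hreg : IsRegular.{u, v} M)
    {I C D K : Set α} {e f : α} (hI : M.Indep I) (hC : M.IsCircuit C) (hD : M.IsCircuit D)
    (hK : M.IsCircuit K) (hCI : C ⊆ insert e (insert f I)) (hDI : D ⊆ insert e (insert f I))
    (hKI : K ⊆ insert e (insert f I)) (heC : e ∈ C) (heD : e ∉ D) (hfC : f ∉ C) (hfD : f ∈ D)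
    (x : α) : x ∈ K ↔ Xor (e ∈ K ∧ x ∈ C) (f ∈ K ∧ x ∈ D) := by
  obtain ⟨n, A, hA⟩ := hreg (ULift.{v} (ZMod 2))
  have h01 : ∀ a : ULift.{v} (ZMod 2), a ≠ 0 → a = 1 := by
    rintro ⟨a⟩ ha
    have : a = 0 ∨ a = 1 := by
      revert a
      decide
    rcases this with rfl | rfl
    · exact absurd rfl ha
    · rfl
  have h11 : (1 + 1 : ULift.{v} (ZMod 2)) = 0 := ULift.ext _ _ (by decide)
  obtain ⟨l, hl, hlK⟩ := hK.exists_linearRelation hA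
  obtain ⟨p, hp, hpC⟩ := hC.exists_linearRelation hA
  obtain ⟨q, hq, hqD⟩ := hD.exists_linearRelation hA
  have val : ∀ {r : α →₀ ULift.{v} (ZMod 2)} {S : Set α}, (r.support : Set α) = S →
      (∀ y ∈ S, r y = 1) ∧ ∀ y ∉ S, r y = 0 := by
    rintro r S rfl
    exact ⟨fun y hy => h01 _ (by simpa using hy), fun y hy => by simpa using hy⟩
  obtain ⟨l1, l0⟩ := val hlK
  obtain ⟨p1, p0⟩ := val hpC
  obtain ⟨q1, q0⟩ := val hqD
  -- The coefficients cancel the entries at `e` and `f`, leaving a relation supported on the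
  -- independent set `I`.
  have hz : l - l e • p - l f • q = 0 := by
    refine linearIndepOn_iff.1 ((hA I hI.subset_ground).1 hI) _ ?_ (by simp [hl, hp, hq])
    rw [Finsupp.mem_supported]
    intro y hy
    by_contra hyI
    refine (Finsupp.mem_support_iff.1 hy) ?_
    by_cases hye : y = e
    · subst hye
      simp only [Finsupp.coe_sub, Finsupp.coe_smul, Pi.sub_apply, Pi.smul_apply, smul_eq_mul]
      rw [p1 _ heC, q0 _ heD]
      ring
    by_cases hyf : y = f
    · subst hyf
      simp only [Finsupp.coe_sub, Finsupp.coe_smul, Pi.sub_apply, Pi.smul_apply, smul_eq_mul]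
      rw [p0 _ hfC, q1 _ hfD]
      ring
    have hn : ∀ {S : Set α}, S ⊆ insert e (insert f I) → y ∉ S := fun h hyS => by
      rcases h hyS with h | h | h
      exacts [hye h, hyf h, hyI h]
    simp [l0 _ (hn hKI), p0 _ (hn hCI), q0 _ (hn hDI)]
  have hx : l x = l e * p x + l f * q x := by
    have := DFunLike.congr_fun hz x
    simp only [Finsupp.coe_sub, Finsupp.coe_smul, Pi.sub_apply, Pi.smul_apply, smul_eq_mul,
      Finsupp.coe_zero, Pi.zero_apply] at this
    linear_combination this
  have hxK : x ∈ K ↔ l x = 1 :=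
    ⟨l1 x, fun h => by_contra fun h' => one_ne_zero (h.symm.trans (l0 x h'))⟩
  rw [hxK, hx]
  by_cases h1 : e ∈ K <;> by_cases h2 : f ∈ K <;> by_cases h3 : x ∈ C <;> by_cases h4 : x ∈ D <;>
    simp [h1, h2, h3, h4, l1, l0, p1, p0, q1, q0, h11, Xor]

end Matroid

namespace OrientedMatroid

/-! ### Sign vectors and signed elimination -/

/-- The vector over `ℤ` with entries `1` on the positive part, `-1` on the negative part. -/
noncomputable def signVector {α : Type u} (X : Set α × Set α) : α → ℤ :=
  X.1.indicator 1 - X.2.indicator 1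

theorem signVector_swap {α : Type u} (X : Set α × Set α) :
    signVector X.swap = -signVector X := by
  simp [signVector]

theorem signVector_apply {α : Type u} {O : OrientedMatroid α} {X : Set α × Set α}
    (hX : X ∈ O.circuits) (x : α) :
    (x ∈ X.1 ∧ x ∉ X.2 ∧ signVector X x = 1) ∨ (x ∉ X.1 ∧ x ∈ X.2 ∧ signVector X x = -1) ∨
      (x ∉ X.1 ∧ x ∉ X.2 ∧ signVector X x = 0) := by
  have : x ∈ X.1 → x ∉ X.2 := fun h => Set.disjoint_left.1 (O.disjoint X hX) h
  by_cases h1 : x ∈ X.1 <;> by_cases h2 : x ∈ X.2 <;> simp_all [signVector]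

theorem isCircuit_of_mem_circuits {α : Type u} {O : OrientedMatroid α} {X : Set α × Set α}
    (hX : X ∈ O.circuits) : O.underlying.IsCircuit (X.1 ∪ X.2) :=
  (O.underlying_isCircuit_iff _).2 ⟨X, hX, rfl⟩

/-- If all circuits obtained by eliminating from `X` and `Y` have support the symmetric difference
of the supports, then `X` and `Y` have opposite signs on the common part of their supports
as soon as they have opposite signs on one common element. -/
theorem signVector_eq_add_of_elimination {α : Type u} {O : OrientedMatroid α}
    {X Y : Set α × Set α} (hX : X ∈ O.circuits) (hY : Y ∈ O.circuits) {b e f : α}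
    (hb : b ∈ X.1 ∩ Y.2) (heX : e ∈ X.1 ∪ X.2) (heY : e ∉ Y.1 ∪ Y.2) (hfX : f ∉ X.1 ∪ X.2)
    (hfY : f ∈ Y.1 ∪ Y.2)
    (H : ∀ W ∈ O.circuits, ∀ g ∈ (X.1 ∪ X.2) ∩ (Y.1 ∪ Y.2), g ∉ W.1 ∪ W.2 →
      W.1 ∪ W.2 ⊆ (X.1 ∪ X.2) ∪ (Y.1 ∪ Y.2) →
      ∀ x, x ∈ W.1 ∪ W.2 ↔ Xor (x ∈ X.1 ∪ X.2) (x ∈ Y.1 ∪ Y.2)) :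
    ∃ Z ∈ O.circuits, (∀ x, x ∈ Z.1 ∪ Z.2 ↔ Xor (x ∈ X.1 ∪ X.2) (x ∈ Y.1 ∪ Y.2)) ∧
      signVector Z = signVector X + signVector Y := by
  have hne : X ≠ Y.swap := by
    rintro rfl
    exact heY (by simpa [or_comm] using heX)
  have hne' : X ≠ Y := by
    rintro rfl
    exact heY heX
  obtain ⟨Z, hZ, hZ1, hZ2⟩ := O.elimination X hX Y hY hne b hb
  have HZ := H Z hZ b ⟨Or.inl hb.1, Or.inr hb.2⟩ (by
    rintro (h | h)
    exacts [(hZ1 h).2 rfl, (hZ2 h).2 rfl]) (by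
    rintro x (h | h)
    · have := (hZ1 h).1
      simp only [Set.mem_union] at this ⊢
      tauto
    · have := (hZ2 h).1
      simp only [Set.mem_union] at this ⊢
      tauto)
  have dX : ∀ x ∈ X.1, x ∉ X.2 := fun x h => Set.disjoint_left.1 (O.disjoint X hX) h
  have dY : ∀ x ∈ Y.1, x ∉ Y.2 := fun x h => Set.disjoint_left.1 (O.disjoint Y hY) h
  have sZ1 : ∀ x ∈ Z.1, x ∈ X.1 ∪ Y.1 := fun x h => (hZ1 h).1
  have sZ2 : ∀ x ∈ Z.2, x ∈ X.2 ∪ Y.2 := fun x h => (hZ2 h).1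
  -- Here `V` arises by eliminating between `X` and `-Y`. It has the same support as `Z`, so `V =
  -- ±Z`. At `f`, `Z` follows `Y` and `V` follows `-Y`, which excludes `V = Z`; at `e` both follow
  -- `X`, which excludes `V = -Z`.
  have main : ∀ V ∈ O.circuits, ∀ g ∈ (X.1 ∪ X.2) ∩ (Y.1 ∪ Y.2),
      V.1 ⊆ (X.1 ∪ Y.2) \ {g} → V.2 ⊆ (X.2 ∪ Y.1) \ {g} → False := by
    intro V hV g hg hV1 hV2
    have HV := H V hV g hg (by
      rintro (h | h)
      exacts [(hV1 h).2 rfl, (hV2 h).2 rfl]) (by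
      rintro x (h | h)
      · have := (hV1 h).1
        simp only [Set.mem_union] at this ⊢
        tauto
      · have := (hV2 h).1
        simp only [Set.mem_union] at this ⊢
        tauto)
    rcases O.incomparable V hV Z hZ fun x hx => (HZ x).2 ((HV x).1 hx) with rfl | rfl
    · rcases (HV f).2 (Or.inr ⟨hfY, hfX⟩) with h | h
      · exact dY f ((hZ1 h).1.resolve_left fun h' => hfX (Or.inl h'))
          ((hV1 h).1.resolve_left fun h' => hfX (Or.inl h'))
      · exact dY f ((hV2 h).1.resolve_left fun h' => hfX (Or.inr h'))
          ((hZ2 h).1.resolve_left fun h' => hfX (Or.inr h'))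
    · rcases (HZ e).2 (Or.inl ⟨heX, heY⟩) with h | h
      · exact dX e ((hZ1 h).1.resolve_right fun h' => heY (Or.inl h'))
          ((hV2 h).1.resolve_right fun h' => heY (Or.inl h'))
      · exact dX e ((hV1 h).1.resolve_right fun h' => heY (Or.inr h'))
          ((hZ2 h).1.resolve_right fun h' => heY (Or.inr h'))
  have opp : ∀ g, g ∈ X.1 → g ∉ Y.1 := by
    intro g hgX hgY
    obtain ⟨V, hV, hV1, hV2⟩ := O.elimination X hX Y.swap (O.swap_mem Y hY) (by simpa using hne')
      g ⟨hgX, hgY⟩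
    exact main V hV g ⟨Or.inl hgX, Or.inl hgY⟩ hV1 hV2
  have opp' : ∀ g, g ∈ X.2 → g ∉ Y.2 := by
    intro g hgX hgY
    obtain ⟨V, hV, hV1, hV2⟩ := O.elimination Y.swap (O.swap_mem Y hY) X hX
      (fun h => hne' (Prod.swap_injective h).symm) g ⟨hgY, hgX⟩
    exact main V hV g ⟨Or.inr hgX, Or.inr hgY⟩ (by rwa [Set.union_comm])
      (by rwa [Set.union_comm])
  refine ⟨Z, hZ, HZ, funext fun x => ?_⟩
  rw [Pi.add_apply]
  have h1 := HZ x
  have h2 := sZ1 x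
  have h3 := sZ2 x
  have h4 := opp x
  have h5 := opp' x
  simp only [Set.mem_union, Xor] at h1 h2 h3
  rcases signVector_apply hZ x with ⟨a1, a2, a⟩ | ⟨a1, a2, a⟩ | ⟨a1, a2, a⟩ <;>
  rcases signVector_apply hX x with ⟨b1, b2, b⟩ | ⟨b1, b2, b⟩ | ⟨b1, b2, b⟩ <;>
  rcases signVector_apply hY x with ⟨c1, c2, c⟩ | ⟨c1, c2, c⟩ | ⟨c1, c2, c⟩ <;>
  simp [a, a1, a2, b, b1, b2, c, c1, c2] at h1 h2 h3 h4 h5 ⊢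

theorem IsSupport.exists_mem_fst {α : Type u} {O : OrientedMatroid α} {C : Set α}
    (hC : O.IsSupport C) {b : α} (hb : b ∈ C) : ∃ X ∈ O.circuits, X.1 ∪ X.2 = C ∧ b ∈ X.1 := by
  obtain ⟨X, hX, rfl⟩ := hC
  rcases hb with hb | hb
  · exact ⟨X, hX, rfl, hb⟩
  · exact ⟨X.swap, O.swap_mem X hX, Set.union_comm _ _, hb⟩

/-- Over `𝔽₂`, the support of a circuit inside `I ∪ {e, f}` is `C`, `D` or their symmetric
difference. Since `Z` contains `e` but misses `b ∈ C`, it is the symmetric difference and `b ∈ D`.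
Orienting `C` and `D` oppositely at `b` makes signed elimination yield `Z` up to sign. -/
theorem exists_signVector_eq_add {α : Type u} {O : OrientedMatroid α}
    (hreg : Matroid.IsRegular.{u, v} O.underlying) {I C D : Set α} {Z : Set α × Set α} {e f b : α}
    (hI : O.underlying.Indep I) (hC : O.underlying.IsCircuit C) (hD : O.underlying.IsCircuit D)
    (hZ : Z ∈ O.circuits) (hCI : C ⊆ insert e I) (hDI : D ⊆ insert f I)
    (hZI : Z.1 ∪ Z.2 ⊆ insert e (insert f I)) (hef : e ≠ f) (heI : e ∉ I) (hfI : f ∉ I)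
    (heC : e ∈ C) (hfD : f ∈ D) (heZ : e ∈ Z.1 ∪ Z.2) (hbC : b ∈ C) (hbZ : b ∉ Z.1 ∪ Z.2) :
    ∃ X ∈ O.circuits, ∃ Y ∈ O.circuits, X.1 ∪ X.2 = C ∧ Y.1 ∪ Y.2 = D ∧
      signVector Z = signVector X + signVector Y := by
  have hCI' : C ⊆ insert e (insert f I) :=
    hCI.trans (Set.insert_subset_insert (Set.subset_insert f I))
  have hDI' : D ⊆ insert e (insert f I) := hDI.trans (Set.subset_insert e _)
  have hfC : f ∉ C := fun h => (hCI h).elim hef.symm hfI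
  have heD : e ∉ D := fun h => (hDI h).elim hef heI
  have bin : ∀ W ∈ O.circuits, W.1 ∪ W.2 ⊆ insert e (insert f I) → ∀ x,
      x ∈ W.1 ∪ W.2 ↔ Xor (e ∈ W.1 ∪ W.2 ∧ x ∈ C) (f ∈ W.1 ∪ W.2 ∧ x ∈ D) := fun W hW hWI x =>
    hreg.mem_circuit_iff hI hC hD (isCircuit_of_mem_circuits hW) hCI' hDI' hWI heC heD hfC hfD x
  have hbZ' := bin Z hZ hZI b
  obtain ⟨hfZ, hbD⟩ : f ∈ Z.1 ∪ Z.2 ∧ b ∈ D :=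
    by_contra fun h => hbZ (hbZ'.2 (Or.inl ⟨⟨heZ, hbC⟩, h⟩))
  rw [underlying_isCircuit_iff] at hC hD
  obtain ⟨X, hX, rfl, hbX⟩ := hC.exists_mem_fst hbC
  obtain ⟨Y, hY, rfl, hbY⟩ : ∃ Y ∈ O.circuits, Y.1 ∪ Y.2 = D ∧ b ∈ Y.2 := by
    obtain ⟨Y, hY, rfl, hbY⟩ := hD.exists_mem_fst hbD
    exact ⟨Y.swap, O.swap_mem Y hY, Set.union_comm _ _, hbY⟩
  obtain ⟨W, hW, hWs, hWv⟩ := signVector_eq_add_of_elimination hX hY ⟨hbX, hbY⟩ heC heD hfC hfD (by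
    intro W hW g hg hgW hWs
    have hWI := hWs.trans (Set.union_subset hCI' hDI')
    obtain ⟨w, hw⟩ := (isCircuit_of_mem_circuits hW).nonempty
    have h1 := bin W hW hWI g
    have h2 := (bin W hW hWI w).1 hw
    have h3 : e ∈ W.1 ∪ W.2 ∧ f ∈ W.1 ∪ W.2 := by
      rcases h2 with ⟨⟨he, _⟩, _⟩ | ⟨⟨hf, _⟩, _⟩
      · exact ⟨he, by_contra fun hf => hgW (h1.2 (Or.inl ⟨⟨he, hg.1⟩, fun h => hf h.1⟩))⟩
      · exact ⟨by_contra fun he => hgW (h1.2 (Or.inr ⟨⟨hf, hg.2⟩, fun h => he h.1⟩)), hf⟩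
    intro x
    simpa only [h3.1, h3.2, true_and] using bin W hW hWI x)
  have hZW : Z.1 ∪ Z.2 ⊆ W.1 ∪ W.2 := fun x hx => by
    rw [hWs]
    simpa only [heZ, hfZ, true_and] using (bin Z hZ hZI x).1 hx
  rcases O.incomparable Z hZ W hW hZW with rfl | rfl
  · exact ⟨X, hX, Y, hY, rfl, rfl, hWv⟩
  · refine ⟨X.swap, O.swap_mem X hX, Y.swap, O.swap_mem Y hY, Set.union_comm _ _,
      Set.union_comm _ _, ?_⟩
    simp only [signVector_swap, hWv]
    ring

/-! ### Fundamental circuits span over `ℤ` -/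

/-- The signed circuits that are fundamental with respect to a base span all signed circuits
over `ℤ`. -/
theorem signVector_mem_span_fundamental {α : Type u} {O : OrientedMatroid α}
    (hreg : Matroid.IsRegular.{u, v} O.underlying) {B : Set α} (hB : O.underlying.IsBase B)
    {X : Set α × Set α} (hX : X ∈ O.circuits) :
    signVector X ∈ Submodule.span ℤ
      (signVector '' {Y | Y ∈ O.circuits ∧ ∃ e, Y.1 ∪ Y.2 ⊆ insert e B}) := by
  induction hn : ((X.1 ∪ X.2) \ B).ncard generalizing B with
  | zero =>
    have hfin : ((X.1 ∪ X.2) \ B).Finite :=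
      O.ground_finite.subset (Set.sdiff_subset.trans (O.subset_ground X hX))
    rw [Set.ncard_eq_zero hfin, Set.sdiff_eq_empty] at hn
    exact absurd (hB.indep.subset hn) (isCircuit_of_mem_circuits hX).not_indep
  | succ n ih =>
    have hfin : ((X.1 ∪ X.2) \ B).Finite :=
      O.ground_finite.subset (Set.sdiff_subset.trans (O.subset_ground X hX))
    obtain ⟨e, heX, heB⟩ : ((X.1 ∪ X.2) \ B).Nonempty := by
      rw [← Set.ncard_pos hfin]
      omega
    by_cases hXe : X.1 ∪ X.2 ⊆ insert e B
    · exact Submodule.subset_span ⟨X, ⟨hX, e, hXe⟩, rfl⟩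
    have heE := O.subset_ground X hX heX
    have hC := hB.fundCircuit_isCircuit heE heB
    set C := O.underlying.fundCircuit e B with hCdef
    have hCB : C ⊆ insert e B := Matroid.fundCircuit_subset_insert _ _ _
    have heC : e ∈ C := Matroid.mem_fundCircuit _ _ _
    -- Exchanging `b` for `e` in the base lowers the number of elements of `X` outside it, because
    -- `b` is not in `X`.
    obtain ⟨b, hbC, hbX⟩ : ∃ b ∈ C, b ∉ X.1 ∪ X.2 := by
      by_contra! h
      exact hXe ((hC.eq_of_subset_isCircuit (isCircuit_of_mem_circuits hX) h) ▸ hCB)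
    have hbe : b ≠ e := fun h => hbX (h ▸ heX)
    have hbB : b ∈ B := (hCB hbC).resolve_left hbe
    have hB' : O.underlying.IsBase (insert e (B \ {b})) := by
      refine hB.exchange_isBase_of_indep heB ?_
      have := (hB.indep.mem_fundCircuit_iff (by rw [hB.closure_eq]; exact heE) heB (x := b)).1 hbC
      rwa [← Set.insert_sdiff_singleton_comm hbe.symm] at this
    have hcard : ((X.1 ∪ X.2) \ insert e (B \ {b})).ncard = n := by
      have : (X.1 ∪ X.2) \ insert e (B \ {b}) = ((X.1 ∪ X.2) \ B) \ {e} := by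
        ext x
        simp only [Set.mem_sdiff, Set.mem_insert_iff, Set.mem_singleton_iff]
        have : x = b → x ∉ X.1 ∪ X.2 := fun h => h ▸ hbX
        tauto
      rw [this, Set.ncard_sdiff_singleton_of_mem (Set.mem_sdiff_of_mem heX heB), hn]
      rfl
    -- It remains to write each fundamental circuit `Z` of the new base through those of `B`. If `Z`
    -- is not already one of these, it lies in `B ∪ {e, f}`, contains `e` and misses `b`, so it is a
    -- sum of two of them.
    refine Submodule.span_le.2 ?_ (ih hB' hcard)
    rintro _ ⟨Z, ⟨hZ, f, hZf⟩, rfl⟩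
    by_cases hZB : ∃ g, Z.1 ∪ Z.2 ⊆ insert g B
    · exact Submodule.subset_span ⟨Z, ⟨hZ, hZB⟩, rfl⟩
    push Not at hZB
    have hZef : Z.1 ∪ Z.2 ⊆ insert e (insert f B) := fun x hx => by
      have := hZf hx
      simp only [Set.mem_insert_iff, Set.mem_sdiff] at this ⊢
      tauto
    have hfB : f ∉ B := fun h => hZB e (by rwa [Set.insert_eq_of_mem h] at hZef)
    have hef : e ≠ f := by
      rintro rfl
      exact hZB e (by rwa [Set.insert_eq_of_mem (Set.mem_insert _ _)] at hZef)
    have heZ : e ∈ Z.1 ∪ Z.2 := by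
      by_contra h
      exact hZB f fun x hx => (hZef hx).resolve_left fun h' => h (h' ▸ hx)
    have hfZ : f ∈ Z.1 ∪ Z.2 := by
      by_contra h
      refine hZB e fun x hx => ?_
      have := hZef hx
      have : x ≠ f := fun h' => h (h' ▸ hx)
      simp only [Set.mem_insert_iff] at *
      tauto
    have hbZ : b ∉ Z.1 ∪ Z.2 := fun h => by
      have := hZf h
      have : b ≠ f := fun h' => hfB (h' ▸ hbB)
      simp only [Set.mem_insert_iff, Set.mem_sdiff, Set.mem_singleton_iff] at *
      tauto
    have hfE := O.subset_ground Z hZ hfZ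
    obtain ⟨X', hX', Y', hY', hXC, hYD, hsum⟩ := exists_signVector_eq_add hreg hB.indep hC
      (hB.fundCircuit_isCircuit hfE hfB) hZ hCB (Matroid.fundCircuit_subset_insert _ _ _) hZef hef
      heB hfB heC (Matroid.mem_fundCircuit _ _ _) heZ hbC hbZ
    rw [SetLike.mem_coe, hsum]
    exact add_mem (Submodule.subset_span ⟨X', ⟨hX', e, hXC ▸ hCB⟩, rfl⟩)
      (Submodule.subset_span ⟨Y', ⟨hY', f, hYD ▸ Matroid.fundCircuit_subset_insert _ _ _⟩, rfl⟩)

/-! ### The flow lattice -/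

/-- The lattice of integral flows: the `ℤ`-span of the signed circuits. -/
def flowLattice {α : Type u} (O : OrientedMatroid α) : Submodule ℤ (α → ℤ) :=
  Submodule.span ℤ (signVector '' O.circuits)

theorem signVector_mem_flowLattice {α : Type u} {O : OrientedMatroid α} {X : Set α × Set α}
    (hX : X ∈ O.circuits) : signVector X ∈ O.flowLattice :=
  Submodule.subset_span ⟨X, hX, rfl⟩

theorem flowLattice_support_subset {α : Type u} {O : OrientedMatroid α} {w : α → ℤ}
    (hw : w ∈ O.flowLattice) : Function.support w ⊆ O.E := by
  induction hw using Submodule.span_induction with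
  | mem w h =>
    obtain ⟨X, hX, rfl⟩ := h
    intro x hx
    refine O.subset_ground X hX ?_
    rcases signVector_apply hX x with h | h | h
    exacts [Or.inl h.1, Or.inr h.2.1, absurd h.2.2 hx]
  | zero => simp
  | add w₁ w₂ _ _ h₁ h₂ =>
    exact (Function.support_add _ _).trans (Set.union_subset h₁ h₂)
  | smul c w _ h => exact (Function.support_const_smul_subset _ _).trans h

theorem signVector_apply_eq_zero_iff {α : Type u} {O : OrientedMatroid α} {X : Set α × Set α}
    (hX : X ∈ O.circuits) (x : α) : signVector X x = 0 ↔ x ∉ X.1 ∪ X.2 := by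
  rw [Set.mem_union]
  rcases signVector_apply hX x with ⟨h1, h2, h⟩ | ⟨h1, h2, h⟩ | ⟨h1, h2, h⟩ <;> simp [h1, h2, h]

/-- A flow supported on a base vanishes. -/
theorem eq_zero_of_support_subset_isBase {α : Type u} {O : OrientedMatroid α}
    (hreg : Matroid.IsRegular.{u, v} O.underlying) {B : Set α} (hB : O.underlying.IsBase B)
    {w : α → ℤ} (hw : w ∈ O.flowLattice) (hwB : Function.support w ⊆ B) : w = 0 := by
  classical
  have hex : ∀ e : ↥(O.E \ B), ∃ X ∈ O.circuits, X.1 ∪ X.2 = O.underlying.fundCircuit e B ∧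
      (e : α) ∈ X.1 := fun e =>
    ((O.underlying_isCircuit_iff _).1 (hB.fundCircuit_isCircuit e.2.1 e.2.2)).exists_mem_fst
      (Matroid.mem_fundCircuit _ _ _)
  choose X hX hXs heX using hex
  have : Finite ↥(O.E \ B) := (O.ground_finite.subset Set.sdiff_subset).to_subtype
  have := Fintype.ofFinite ↥(O.E \ B)
  have hspan : w ∈ Submodule.span ℤ (Set.range fun e => signVector (X e)) := by
    refine Submodule.span_le.2 ?_ hw
    rintro _ ⟨Y, hY, rfl⟩
    refine Submodule.span_le.2 ?_ (signVector_mem_span_fundamental hreg hB hY)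
    rintro _ ⟨Z, ⟨hZ, e, hZe⟩, rfl⟩
    have hZc := isCircuit_of_mem_circuits hZ
    have heZ : e ∈ Z.1 ∪ Z.2 := by
      by_contra h
      exact hZc.not_indep (hB.indep.subset fun x hx =>
        (hZe hx).resolve_left fun h' => h (h' ▸ hx))
    have heB : e ∉ B := fun h => hZc.not_indep
      (hB.indep.subset (by rwa [Set.insert_eq_of_mem h] at hZe))
    have hZX := hZc.eq_fundCircuit_of_subset hB.indep hZe
    let e' : ↥(O.E \ B) := ⟨e, O.subset_ground Z hZ heZ, heB⟩
    have hmem : signVector (X e') ∈ Submodule.span ℤ (Set.range fun e => signVector (X e)) :=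
      Submodule.subset_span ⟨e', rfl⟩
    rcases O.incomparable Z hZ (X e') (hX e') (by rw [hXs, hZX]) with h | h
    · rwa [h]
    · rw [h, signVector_swap]
      exact neg_mem hmem
  rw [Submodule.mem_span_range_iff_exists_fun] at hspan
  obtain ⟨c, rfl⟩ := hspan
  refine Finset.sum_eq_zero fun e _ => ?_
  -- Among the chosen fundamental circuits only that of `e` passes through `e`, so the coordinate at
  -- `e` is its coefficient.
  have h0 : (∑ i, c i • signVector (X i)) (e : α) = 0 := by
    by_contra h
    exact e.2.2 (hwB h)
  rw [Finset.sum_apply, Finset.sum_eq_single e] at h0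
  · have h1 : signVector (X e) e = 1 := by
      rcases signVector_apply (hX e) e with h | h | h
      exacts [h.2.2, absurd (heX e) h.1, absurd (heX e) h.1]
    rw [Pi.smul_apply, h1, smul_eq_mul, mul_one] at h0
    rw [h0, zero_smul]
  · intro i _ hie
    rw [Pi.smul_apply, (signVector_apply_eq_zero_iff (hX i) e).2, smul_zero]
    rw [hXs]
    intro h
    rcases Matroid.fundCircuit_subset_insert _ _ _ h with h' | h'
    · exact hie (Subtype.ext h'.symm)
    · exact e.2.2 h'
  · simp

/-! ### Decomposing nonnegative flows -/

/-- The support of `w` is dependent, so it contains a circuit. Subtracting as large a multiple of it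
as nonnegativity allows shrinks the support; the induction ends when nothing is left, and then that
circuit is itself directed. -/
theorem exists_isDirectedCircuit_subset_support {α : Type u} {O : OrientedMatroid α}
    (hreg : Matroid.IsRegular.{u, v} O.underlying) {w : α → ℤ} (hw : w ∈ O.flowLattice)
    (hw0 : 0 ≤ w) (hne : w ≠ 0) : ∃ C, O.IsDirectedCircuit C ∧ C ⊆ Function.support w := by
  induction hn : (Function.support w).ncard using Nat.strong_induction_on generalizing w with
  | _ n ih =>
  have hwE := flowLattice_support_subset hw
  have hdep : ¬ O.underlying.Indep (Function.support w) := fun h => by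
    obtain ⟨B, hB, hwB⟩ := h.exists_isBase_superset
    exact hne (eq_zero_of_support_subset_isBase hreg hB hw hwB)
  obtain ⟨C, hCw, hC⟩ := ((Matroid.not_indep_iff hwE).1 hdep).exists_isCircuit_subset
  obtain ⟨c, hc⟩ := hC.nonempty
  obtain ⟨X, hX, rfl, hcX⟩ := ((O.underlying_isCircuit_iff C).1 hC).exists_mem_fst hc
  have hfin : X.1.Finite :=
    O.ground_finite.subset (Set.subset_union_left.trans (O.subset_ground X hX))
  -- Subtraction lowers `w` only on `X.1`, so the minimum of `w` there is the largest admissible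
  -- multiple.
  obtain ⟨a, haX, hamin⟩ := Set.exists_min_image X.1 w hfin ⟨c, hcX⟩
  set w' := w - w a • signVector X with hw'
  have hw'x : ∀ x, w' x = w x - w a * signVector X x := fun x => rfl
  have hw'mem : w' ∈ O.flowLattice :=
    sub_mem hw (Submodule.smul_mem _ _ (signVector_mem_flowLattice hX))
  have hw'0 : 0 ≤ w' := fun x => by
    have h1 := hw0 x
    have h2 := hw0 a
    simp only [Pi.zero_apply] at h1 h2 ⊢
    rw [hw'x]
    rcases signVector_apply hX x with ⟨h, _, hs⟩ | ⟨_, _, hs⟩ | ⟨_, _, hs⟩ <;> rw [hs]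
    · have := hamin x h
      linarith
    · linarith
    · linarith
  have ha' : w' a = 0 := by
    rw [hw'x]
    rcases signVector_apply hX a with ⟨_, _, hs⟩ | ⟨h, _⟩ | ⟨h, _⟩
    · rw [hs]
      ring
    all_goals exact absurd haX h
  have hsub : Function.support w' ⊆ Function.support w := fun x hx hxw => by
    refine hx ?_
    rw [hw'x, hxw, (signVector_apply_eq_zero_iff hX x).2 fun h => hCw h hxw]
    ring
  by_cases hz : w' = 0
  · refine ⟨X.1, ?_, Set.subset_union_left.trans hCw⟩
    -- Now `w` is a positive multiple of the sign vector of `X`, and a negative entry would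
    -- contradict `0 ≤ w`.
    have hX2 : X.2 = ∅ := by
      refine Set.eq_empty_of_forall_notMem fun x hx => ?_
      have h1 := congrFun hz x
      have h2 := hw0 x
      have h3 := hw0 a
      have h4 : w x ≠ 0 := hCw (Or.inr hx)
      simp only [Pi.zero_apply] at h1 h2 h3
      rw [hw'x] at h1
      rcases signVector_apply hX x with ⟨_, h, _⟩ | ⟨_, _, hs⟩ | ⟨_, h, _⟩
      · exact h hx
      · rw [hs] at h1
        omega
      · exact h hx
    rw [IsDirectedCircuit, ← hX2]
    exact hX
  · have hlt : (Function.support w').ncard < n := by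
      rw [← hn]
      refine Set.ncard_lt_ncard ⟨hsub, fun h => ?_⟩ (O.ground_finite.subset hwE)
      exact h (hCw (Or.inl haX)) ha'
    obtain ⟨D, hD, hDw⟩ := ih _ hlt hw'mem hw'0 hz rfl
    exact ⟨D, hD, hDw.trans hsub⟩

/-- A nonnegative integral flow is a sum of directed circuits. -/
theorem mem_closure_directed_of_nonneg {α : Type u} {O : OrientedMatroid α}
    (hreg : Matroid.IsRegular.{u, v} O.underlying) {S : Set α} {w : α → ℤ}
    (hw : w ∈ O.flowLattice) (hw0 : 0 ≤ w) (hwS : Function.support w ⊆ S) :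
    w ∈ AddSubmonoid.closure
      ((fun C : Set α => signVector (C, ∅)) '' {C | O.IsDirectedCircuit C ∧ C ⊆ S}) := by
  -- The induction is on the total mass of `w`: by integrality `w ≥ 1` on a directed circuit in its
  -- support, so the circuit can be subtracted once.
  induction hn : ∑ x ∈ O.ground_finite.toFinset, (w x).toNat using Nat.strong_induction_on
    generalizing w with
  | _ n ih =>
  by_cases hne : w = 0
  · rw [hne]
    exact zero_mem _
  obtain ⟨C, hC, hCw⟩ := exists_isDirectedCircuit_subset_support hreg hw hw0 hne
  have hval : ∀ x, (x ∈ C ∧ signVector (C, ∅) x = 1) ∨ (x ∉ C ∧ signVector (C, ∅) x = 0) := by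
    intro x
    by_cases h : x ∈ C <;> simp [signVector, h]
  have hpos : ∀ x ∈ C, 0 < w x := fun x hx => lt_of_le_of_ne (hw0 x) (Ne.symm (hCw hx))
  have hle : ∀ x, 0 ≤ w x - signVector (C, ∅) x := fun x => by
    rcases hval x with ⟨h, hs⟩ | ⟨h, hs⟩ <;> rw [hs]
    · have := hpos x h
      omega
    · simpa using hw0 x
  have hmem := ih (∑ x ∈ O.ground_finite.toFinset, ((w - signVector (C, ∅)) x).toNat) ?_
    (sub_mem hw (signVector_mem_flowLattice hC)) hle ?_ rfl
  · rw [← sub_add_cancel w (signVector (C, ∅))]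
    exact add_mem hmem (AddSubmonoid.subset_closure ⟨C, ⟨hC, hCw.trans hwS⟩, rfl⟩)
  · rw [← hn]
    obtain ⟨c, hc⟩ := (isCircuit_of_mem_circuits hC).nonempty
    have hcC : c ∈ C := by simpa using hc
    refine Finset.sum_lt_sum (fun x _ => ?_) ⟨c, ?_, ?_⟩
    · rw [Pi.sub_apply]
      rcases hval x with ⟨h, hs⟩ | ⟨h, hs⟩ <;> rw [hs] <;> omega
    · simpa using O.subset_ground _ hC hc
    · rw [Pi.sub_apply]
      have := hpos c hcC
      rcases hval c with ⟨h, hs⟩ | ⟨h, hs⟩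
      · rw [hs]
        omega
      · exact absurd hcC h
  · intro x hx
    refine hwS fun h => hx ?_
    rw [Pi.sub_apply, h]
    rcases hval x with ⟨h', hs⟩ | ⟨h', hs⟩
    · exact absurd h (hCw h')
    · rw [hs, sub_zero]

theorem exists_isDirectedCircuit_mem {α : Type u} {O : OrientedMatroid α}
    (hreg : Matroid.IsRegular.{u, v} O.underlying) {w : α → ℤ} (hw : w ∈ O.flowLattice)
    (hw0 : 0 ≤ w) {a : α} (ha : w a ≠ 0) :
    ∃ C, O.IsDirectedCircuit C ∧ a ∈ C ∧ C ⊆ Function.support w := by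
  have key : ∀ u ∈ AddSubmonoid.closure ((fun C : Set α => signVector (C, ∅)) ''
      {C | O.IsDirectedCircuit C ∧ C ⊆ Function.support w}),
      u a ≠ 0 → ∃ C, O.IsDirectedCircuit C ∧ a ∈ C ∧ C ⊆ Function.support w := by
    intro u hu
    induction hu using AddSubmonoid.closure_induction with
    | mem u h =>
      obtain ⟨C, ⟨hC, hCw⟩, rfl⟩ := h
      intro h
      refine ⟨C, hC, ?_, hCw⟩
      by_contra haC
      exact h (by simp [signVector, haC])
    | zero => exact fun h => absurd rfl h
    | add u₁ u₂ _ _ h₁ h₂ =>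
      intro h
      by_cases h' : u₁ a = 0
      · exact h₂ fun h'' => h (by rw [Pi.add_apply, h', h'', add_zero])
      · exact h₁ h'
  exact key w (mem_closure_directed_of_nonneg hreg hw hw0 subset_rfl) ha

/-! ### Directed circuits adapted to `A` -/

/-- If the deletion of `A` is totally cyclic, there is a flow that vanishes on `A` and is positive
elsewhere. -/
theorem exists_positive_flow {α : Type u} {O : OrientedMatroid α} {A : Set α}
    (hcyc : (O.delete A).IsTotallyCyclic) :
    ∃ p ∈ O.flowLattice, 0 ≤ p ∧ (∀ x ∈ A, p x = 0) ∧ ∀ x ∈ O.E \ A, 0 < p x := by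
  have hex : ∀ e : ↥(O.E \ A), ∃ C, (O.delete A).IsDirectedCircuit C ∧ (e : α) ∈ C :=
    fun e => hcyc e e.2
  choose C hC heC using hex
  have : Finite ↥(O.E \ A) := (O.ground_finite.subset Set.sdiff_subset).to_subtype
  have := Fintype.ofFinite ↥(O.E \ A)
  have hnn : ∀ (e : ↥(O.E \ A)) x, 0 ≤ signVector (C e, ∅) x := fun e x => by
    by_cases h : x ∈ C e <;> simp [signVector, h]
  refine ⟨∑ e, signVector (C e, ∅), sum_mem fun e _ => signVector_mem_flowLattice (hC e).1,
    fun x => ?_, fun x hx => ?_, fun x hx => ?_⟩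
  · rw [Finset.sum_apply]
    exact Finset.sum_nonneg fun e _ => hnn e x
  · rw [Finset.sum_apply]
    refine Finset.sum_eq_zero fun e _ => ?_
    rw [signVector_apply_eq_zero_iff (hC e).1]
    exact fun h => Set.disjoint_left.1 (hC e).2 h hx
  · rw [Finset.sum_apply]
    refine Finset.sum_pos' (fun e _ => hnn e x) ⟨⟨x, hx⟩, Finset.mem_univ _, ?_⟩
    have := heC ⟨x, hx⟩
    simp [signVector, this]

/-- Take a base avoiding `A` and the fundamental circuit of `a`, positive at `a`. Its negative
entries lie in the base, where `p ≥ 1`, so adding `p` gives a nonnegative flow whose support meets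
`A` only in `a`. A directed circuit through `a` in this support is as wanted. -/
theorem exists_isDirectedCircuit_inter_eq_singleton {α : Type u} {O : OrientedMatroid α}
    (hreg : Matroid.IsRegular.{u, v} O.underlying) {A : Set α} (hA : O.underlying.Coindep A)
    {p : α → ℤ} (hp : p ∈ O.flowLattice) (hp0 : 0 ≤ p) (hpA : ∀ x ∈ A, p x = 0)
    (hpE : ∀ x ∈ O.E \ A, 0 < p x) {a : α} (ha : a ∈ A) :
    ∃ D, O.IsDirectedCircuit D ∧ D ∩ A = {a} := by
  obtain ⟨B, hB, hBA⟩ := hA.exists_isBase_subset_compl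
  have haB : a ∉ B := fun h => (hBA h).2 ha
  obtain ⟨X, hX, hXC, haX⟩ := ((O.underlying_isCircuit_iff _).1
    (hB.fundCircuit_isCircuit (hA.subset_ground ha) haB)).exists_mem_fst
      (Matroid.mem_fundCircuit _ _ _)
  have hXB : X.1 ∪ X.2 ⊆ insert a B := hXC ▸ Matroid.fundCircuit_subset_insert _ _ _
  have hXa : signVector X a = 1 := by
    rcases signVector_apply hX a with h | h | h
    exacts [h.2.2, absurd haX h.1, absurd haX h.1]
  obtain ⟨D, hD, haD, hDs⟩ := exists_isDirectedCircuit_mem hreg (w := signVector X + p) (a := a)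
    (add_mem (signVector_mem_flowLattice hX) hp) (fun x => by
      have := hp0 x
      simp only [Pi.zero_apply, Pi.add_apply] at this ⊢
      rcases signVector_apply hX x with ⟨_, _, hs⟩ | ⟨h1, h2, hs⟩ | ⟨_, _, hs⟩ <;> rw [hs]
      · omega
      · have := hpE x (hBA ((hXB (Or.inr h2)).resolve_left fun h => h1 (h ▸ haX)))
        omega
      · omega) (by simp [hXa, hpA a ha])
  refine ⟨D, hD, Set.Subset.antisymm ?_ (Set.singleton_subset_iff.2 ⟨haD, ha⟩)⟩
  rintro x ⟨hxD, hxA⟩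
  have hx := hDs hxD
  rw [Function.mem_support, Pi.add_apply, hpA x hxA, add_zero, Ne,
    signVector_apply_eq_zero_iff hX, not_not] at hx
  exact (hXB hx).resolve_right fun h => (hBA h).2 hxA

/-- The circuits `D a` restrict to unit vectors on `A`, so they can be used to clear the entries of
`X` there. The remainder is a difference of two nonnegative flows vanishing on `A`, each a sum of
directed circuits avoiding `A`. -/
theorem signVector_mem_span_directed {α : Type u} {O : OrientedMatroid α}
    (hreg : Matroid.IsRegular.{u, v} O.underlying) {A : Set α} (hA : A ⊆ O.E)
    {p : α → ℤ} (hp : p ∈ O.flowLattice) (hp0 : 0 ≤ p) (hpA : ∀ x ∈ A, p x = 0)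
    (hpE : ∀ x ∈ O.E \ A, 0 < p x) {D : α → Set α} (hD : ∀ a ∈ A, O.IsDirectedCircuit (D a))
    (hDA : ∀ a ∈ A, D a ∩ A = {a}) {X : Set α × Set α} (hX : X ∈ O.circuits) :
    signVector X ∈ Submodule.span ℤ ((fun C : Set α => signVector (C, ∅)) ''
      ({C | O.IsDirectedCircuit C ∧ C ⊆ Aᶜ} ∪ D '' A)) := by
  set G := {C | O.IsDirectedCircuit C ∧ C ⊆ Aᶜ} ∪ D '' A with hG
  have hdec : ∀ u ∈ O.flowLattice, 0 ≤ u → (∀ x ∈ A, u x = 0) →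
      u ∈ Submodule.span ℤ ((fun C : Set α => signVector (C, ∅)) '' G) := by
    intro u hu hu0 huA
    have hcl := mem_closure_directed_of_nonneg hreg (S := Aᶜ) hu hu0 fun x hx hxA => hx (huA x hxA)
    have hle : AddSubmonoid.closure ((fun C : Set α => signVector (C, ∅)) ''
        {C | O.IsDirectedCircuit C ∧ C ⊆ Aᶜ}) ≤
        (Submodule.span ℤ ((fun C : Set α => signVector (C, ∅)) '' G)).toAddSubmonoid :=
      AddSubmonoid.closure_le.2
        ((Set.image_mono Set.subset_union_left).trans Submodule.subset_span)
    exact hle hcl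
  have hAfin : A.Finite := O.ground_finite.subset hA
  set s : α → ℤ := ∑ a ∈ hAfin.toFinset, signVector X a • signVector (D a, ∅) with hs
  have hsG : s ∈ Submodule.span ℤ ((fun C : Set α => signVector (C, ∅)) '' G) :=
    sum_mem fun a ha => Submodule.smul_mem _ _
      (Submodule.subset_span ⟨D a, Or.inr ⟨a, by simpa using ha, rfl⟩, rfl⟩)
  have hsL : s ∈ O.flowLattice := sum_mem fun a ha => Submodule.smul_mem _ _
    (signVector_mem_flowLattice (hD a (by simpa using ha)))
  have hsA : ∀ x ∈ A, s x = signVector X x := by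
    intro x hx
    rw [hs, Finset.sum_apply, Finset.sum_eq_single x]
    · have : x ∈ D x := ((hDA x hx).symm ▸ Set.mem_singleton x : x ∈ D x ∩ A).1
      simp [signVector, this]
    · intro a ha hax
      rw [Pi.smul_apply, (signVector_apply_eq_zero_iff (hD a (by simpa using ha)) x).2, smul_zero]
      rintro (h | h)
      · have : x ∈ D a ∩ A := ⟨h, hx⟩
        rw [hDA a (by simpa using ha)] at this
        exact hax this.symm
      · exact h
    · intro h
      exact absurd (by simpa using hx) h
  set d := signVector X - s with hd
  have hdL : d ∈ O.flowLattice := sub_mem (signVector_mem_flowLattice hX) hsL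
  have hdA : ∀ x ∈ A, d x = 0 := fun x hx => by rw [hd, Pi.sub_apply, hsA x hx, sub_self]
  -- A crude bound on every `|d x|`; since `p ≥ 1` on the rest of the ground set, `d + N • p` is
  -- nonnegative.
  set N : ℤ := ∑ x ∈ O.ground_finite.toFinset, |d x| with hN
  have hw := hdec (d + N • p) (add_mem hdL (Submodule.smul_mem _ _ hp)) (fun x => by
      simp only [Pi.zero_apply, Pi.add_apply, Pi.smul_apply, smul_eq_mul]
      by_cases hxA : x ∈ A
      · simp [hdA x hxA, hpA x hxA]
      by_cases hxE : x ∈ O.E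
      · have h1 : |d x| ≤ N := Finset.single_le_sum (f := fun x => |d x|)
          (fun y _ => abs_nonneg _) (by simpa using hxE)
        have h2 := hpE x ⟨hxE, hxA⟩
        have h3 := neg_abs_le (d x)
        have h4 := abs_nonneg (d x)
        nlinarith
      · have h1 : d x = 0 := by
          by_contra h
          exact hxE (flowLattice_support_subset hdL h)
        have h2 : p x = 0 := by
          by_contra h
          exact hxE (flowLattice_support_subset hp h)
        simp [h1, h2])
    (fun x hx => by simp [hdA x hx, hpA x hx])
  have hX' : signVector X = (d + N • p) - N • p + s := by
    rw [hd]
    abel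
  rw [hX']
  exact add_mem (sub_mem hw (Submodule.smul_mem _ _ (hdec p hp hp0 hpA))) hsG

/-! ### Reduction modulo 2 and the basis -/

/-- Signs disappear modulo 2, so an integral combination of sign vectors reduces to one of incidence
vectors. -/
theorem incidenceVector_mem_span {α : Type u} {O : OrientedMatroid α} {G : Set (Set α)}
    {X : Set α × Set α} (hX : X ∈ O.circuits)
    (h : signVector X ∈ Submodule.span ℤ ((fun C : Set α => signVector (C, ∅)) '' G)) :
    Matroid.incidenceVector (X.1 ∪ X.2) ∈
      Submodule.span (ZMod 2) (Matroid.incidenceVector '' G) := by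
  have key : ∀ u ∈ Submodule.span ℤ ((fun C : Set α => signVector (C, ∅)) '' G),
      (fun x => (u x : ZMod 2)) ∈ Submodule.span (ZMod 2) (Matroid.incidenceVector '' G) := by
    intro u hu
    induction hu using Submodule.span_induction with
    | mem u hu =>
      obtain ⟨C, hC, rfl⟩ := hu
      refine Submodule.subset_span ⟨C, hC, funext fun x => ?_⟩
      by_cases hx : x ∈ C <;> simp [Matroid.incidenceVector, signVector, hx]
    | zero =>
      have h0 : (fun x => (((0 : α → ℤ) x : ℤ) : ZMod 2)) = 0 := funext fun x => by simp
      rw [h0]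
      exact zero_mem _
    | add u₁ u₂ _ _ h₁ h₂ =>
      convert add_mem h₁ h₂ using 1
      ext x
      simp
    | smul c u _ hu =>
      convert zsmul_mem hu c using 1
      ext x
      simp
  convert key _ h using 1
  ext x
  rcases signVector_apply hX x with ⟨h1, h2, hs⟩ | ⟨h1, h2, hs⟩ | ⟨h1, h2, hs⟩ <;>
    simp [Matroid.incidenceVector, hs, h1, h2]

theorem linearIndepOn_incidenceVector_image {α : Type u} {A : Set α} {D : α → Set α}
    (hDA : ∀ a ∈ A, D a ∩ A = {a}) :
    LinearIndepOn (ZMod 2) Matroid.incidenceVector (D '' A) := by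
  rw [linearIndepOn_iff]
  intro l hl h0
  rw [Finsupp.mem_supported] at hl
  ext C
  by_contra hC
  obtain ⟨a, ha, rfl⟩ := hl (Finsupp.mem_support_iff.2 hC)
  have haD : a ∈ D a := ((hDA a ha).symm ▸ Set.mem_singleton a : a ∈ D a ∩ A).1
  -- At coordinate `a` only `D a` contributes, so its coefficient is zero.
  have h1 := congrFun h0 a
  rw [Finsupp.linearCombination_apply, Finsupp.sum, Finset.sum_apply,
    Finset.sum_eq_single (D a)] at h1
  · exact hC (by simpa [Matroid.incidenceVector, haD] using h1)
  · intro C' hC' hne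
    obtain ⟨a', ha', rfl⟩ := hl hC'
    have : a ∉ D a' := fun h => by
      have : a ∈ D a' ∩ A := ⟨h, ha⟩
      rw [hDA a' ha'] at this
      exact hne (congrArg D this.symm)
    simp [Matroid.incidenceVector, this]
  · intro h
    simp [Finsupp.notMem_support_iff.1 h]

/-- The basis extends the independent family `D '' A` within the spanning set. Every added circuit
avoids `A`, so `D a` stays the only member through `a`. -/
theorem exists_isDirectedCircuitBasis {α : Type u} {O : OrientedMatroid α}
    (hreg : Matroid.IsRegular.{u, v} O.underlying) {A : Set α} (hA : O.underlying.Coindep A)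
    (hcyc : (O.delete A).IsTotallyCyclic) :
    ∃ B : Set (Set α), O.IsDirectedCircuitBasis B ∧ ∀ a ∈ A, ∃! C, C ∈ B ∧ a ∈ C := by
  obtain ⟨p, hp, hp0, hpA, hpE⟩ := exists_positive_flow hcyc
  have hex : ∀ a, ∃ D, a ∈ A → O.IsDirectedCircuit D ∧ D ∩ A = {a} := fun a => by
    by_cases ha : a ∈ A
    · obtain ⟨D, hD⟩ := exists_isDirectedCircuit_inter_eq_singleton hreg hA hp hp0 hpA hpE ha
      exact ⟨D, fun _ => hD⟩
    · exact ⟨∅, fun h => absurd h ha⟩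
  choose D hD using hex
  have hDA : ∀ a ∈ A, D a ∩ A = {a} := fun a ha => (hD a ha).2
  have haD : ∀ a ∈ A, a ∈ D a := fun a ha =>
    ((hDA a ha).symm ▸ Set.mem_singleton a : a ∈ D a ∩ A).1
  obtain ⟨B, hBG, hDB, hspan, hind⟩ :=
    exists_linearIndepOn_extension (linearIndepOn_incidenceVector_image hDA)
      (Set.subset_union_right (s := {C | O.IsDirectedCircuit C ∧ C ⊆ Aᶜ}))
  have hdir : ∀ C ∈ B, O.IsDirectedCircuit C := fun C hC => by
    rcases hBG hC with h | ⟨a, ha, rfl⟩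
    exacts [h.1, (hD a ha).1]
  have hcirc : ∀ C ∈ B, O.underlying.IsCircuit C := fun C hC => by
    simpa using isCircuit_of_mem_circuits (hdir C hC)
  refine ⟨B, ⟨⟨hcirc, hind, le_antisymm (Submodule.span_mono (Set.image_mono hcirc)) ?_⟩, hdir⟩,
    fun a ha => ⟨D a, ⟨hDB ⟨a, ha, rfl⟩, haD a ha⟩, ?_⟩⟩
  · refine Submodule.span_le.2 ?_
    rintro _ ⟨C, hC, rfl⟩
    obtain ⟨X, hX, rfl⟩ := (O.underlying_isCircuit_iff C).1 hC
    exact Submodule.span_le.2 hspan (incidenceVector_mem_span hX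
      (signVector_mem_span_directed hreg hA.subset_ground hp hp0 hpA hpE
        (fun a ha => (hD a ha).1) hDA hX))
  · rintro C ⟨hCB, haC⟩
    rcases hBG hCB with h | ⟨a', ha', rfl⟩
    · exact absurd ha (h.2 haC)
    · have : a ∈ D a' ∩ A := ⟨haC, ha⟩
      rw [hDA a' ha'] at this
      exact congrArg D this.symm

end OrientedMatroid

theorem mainTheorem8 {α : Type u} (O : OrientedMatroid α)
    (hreg : Matroid.IsRegular.{u, v} O.underlying) :
    (O.IsTotallyCyclic → ∃ B : Set (Set α), O.IsDirectedCircuitBasis B) ∧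
    (∀ A : Set α, O.underlying.Coindep A → (O.delete A).IsTotallyCyclic →
      ∃ B : Set (Set α), O.IsDirectedCircuitBasis B ∧ ∀ a ∈ A, ∃! C, C ∈ B ∧ a ∈ C) := by
  refine ⟨fun h => ?_, fun A hA hcyc => O.exists_isDirectedCircuitBasis hreg hA hcyc⟩
  obtain ⟨B, hB, -⟩ := O.exists_isDirectedCircuitBasis hreg (A := ∅) (Matroid.empty_indep O.underlying✶)
    fun e he => by
      obtain ⟨C, hC, heC⟩ := h e he.1
      exact ⟨C, ⟨hC, Set.disjoint_empty _⟩, heC⟩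
  exact ⟨B, hB⟩
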